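/- Let $d\ge 0$, let $\mathbb{R}^{d,1}$ be $\mathbb{R}^{d}\times\mathbb{R}$ with the bilinear form $\langle x,y\rangle_{d,1}=x_1y_1+\dots+x_dy_d-x_{d+1}y_{d+1}$, and write $v=(\bar v,v_{d+1})$ for $v\in\mathbb{R}^{d,1}$. Let $O_+(d,1)$ be the group of linear isometries of $\mathbb{R}^{d,1}$ preserving $\mathcal{H}^d=\{x : \langle x,x\rangle_{d,1}=-1,\ x_{d+1}>0\}$, and let $\Gamma\subset O_+(d,1)$ be a subgroup such that $\mathcal{H}^d/\Gamma$ is a compact hyperbolic manifold (i.e. $\Gamma$ acts freely and properly discontinuously on $\mathcal{H}^d$ with compact quotient). Let $Z^1(\Gamma,\mathbb{R}^{d,1})$ be the space of cocycles, i.e. of maps $\tau:\Gamma\to\mathbb{R}^{d,1}$ with $\tau(AB)=\tau(A)+A(\tau(B))$ for all $A,B\in\Gamma$, with the topology of pointwise convergence. Let $B^d$ be the open Euclidean unit ball of $\mathbb{R}^d$ and $L(x)=\sqrt{1-\|x\|^2}$. The group $O_+(d,1)$ acts on $B^d$ by letting $A\cdot x$ be the point for which $\binom{A\cdot x}{1}$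 is proportional to $A\binom{x}{1}$. A continuous function $h:B^d\to\mathbb{R}$ is called $\tau$-equivariant if for all $A\in\Gamma$ and $x\in B^d$ $$\frac{L(x)}{L(A^{-1}\cdot x)}\,h(A^{-1}\cdot x)+\langle x,\overline{\tau(A)}\rangle_d-\tau(A)_{d+1}=h(x).$$ Then for every cocycle $\tau\in Z^1(\Gamma,\mathbb{R}^{d,1})$ there exists a $C^\infty$ convex $\tau$-equivariant function $h(\tau):B^d\to\mathbb{R}$. Moreover, the functions $h(\tau)$ can be chosen, simultaneously for all $\tau$, so that whenever $\tau_n\to\tau$ in $Z^1(\Gamma,\mathbb{R}^{d,1})$, the functions $h(\tau_n)$ converge to $h(\tau)$ and the second partial derivatives of $h(\tau_n)$ converge to those of $h(\tau)$, uniformly on compact subsets of $B^d$. The same holds with "concave" in place of "convex". -/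

import Mathlib

open Set Filter Topology
open scoped ContDiff

namespace CoMinkowski

noncomputable section

/-- Euclidean space `ℝ^d`. -/
abbrev E (d : ℕ) : Type := EuclideanSpace ℝ (Fin d)

/-- The vector space underlying Minkowski space `ℝ^{d,1}`; a vector is written
`(x.1, x.2)` with horizontal component `x.1 ∈ ℝ^d` and vertical component `x.2 ∈ ℝ`. -/
abbrev V (d : ℕ) : Type := E d × ℝ

/-- The Minkowski bilinear form `x₁y₁ + ⋯ + x_d y_d - x_{d+1} y_{d+1}`. -/
def mink {d : ℕ} (x y : V d) : ℝ := inner ℝ x.1 y.1 - x.2 * y.2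

/-- The hyperboloid model `ℋ^d` of hyperbolic space. -/
def hyperboloid (d : ℕ) : Set (V d) := {x | mink x x = -1 ∧ 0 < x.2}

/-- The group `O_+(d,1)` of linear isometries of Minkowski space preserving `ℋ^d`. -/
def OPlus (d : ℕ) : Subgroup (V d ≃ₗ[ℝ] V d) where
  carrier := {A | (∀ x y, mink (A x) (A y) = mink x y) ∧ A '' hyperboloid d = hyperboloid d}
  one_mem' := ⟨fun _ _ => rfl, by simp⟩
  mul_mem' := by
    rintro A B ⟨hA, hA'⟩ ⟨hB, hB'⟩
    refine ⟨fun x y => ?_, ?_⟩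
    · rw [LinearEquiv.mul_apply, LinearEquiv.mul_apply, hA, hB]
    · have h : (⇑(A * B) : V d → V d) = A ∘ B := rfl
      rw [h, Set.image_comp, hB', hA']
  inv_mem' := by
    rintro A ⟨hA, hA'⟩
    refine ⟨fun x y => ?_, ?_⟩
    · rw [← hA (A⁻¹ x) (A⁻¹ y)]
      exact congrArg₂ mink (A.apply_symm_apply x) (A.apply_symm_apply y)
    · have h : (⇑A⁻¹ : V d → V d) ∘ A = id := funext fun x => A.symm_apply_apply x
      conv_lhs => rw [← hA']
      rw [← Set.image_comp, h, Set.image_id]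

/-- The action of `O_+(d,1)` on the hyperboloid. -/
instance (d : ℕ) : MulAction (OPlus d) (hyperboloid d) where
  smul A p := ⟨A.1 p.1, A.2.2.subset (Set.mem_image_of_mem A.1 p.2)⟩
  one_smul _ := rfl
  mul_smul _ _ _ := rfl

/-- `ℋ^d / Γ` is a compact hyperbolic manifold: `Γ` acts freely and properly discontinuously
on `ℋ^d`, with compact quotient. -/
structure IsCompactHyperbolicManifold {d : ℕ} (Γ : Subgroup (OPlus d)) : Prop where
  free : ∀ (A : Γ) (p : hyperboloid d), A • p = p → A = 1
  properlyDiscontinuous : ProperlyDiscontinuousSMul Γ (hyperboloid d)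
  compact_quotient : CompactSpace (MulAction.orbitRel.Quotient Γ (hyperboloid d))

/-- The space `Z¹(Γ, ℝ^{d,1})` of cocycles. Its topology is that of pointwise convergence. -/
def Z1 {d : ℕ} (Γ : Subgroup (OPlus d)) : Submodule ℝ (Γ → V d) where
  carrier := {τ | ∀ A B : Γ, τ (A * B) = τ A + A.1.1 (τ B)}
  zero_mem' := fun A B => by simp
  add_mem' := by
    intro σ τ hσ hτ A B
    simp only [Pi.add_apply, hσ A B, hτ A B, map_add]
    abel
  smul_mem' := by
    intro c τ hτ A B
    simp only [Pi.smul_apply, hτ A B, map_smul, smul_add]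

/-- The open unit ball `B^d`. -/
def B (d : ℕ) : Set (E d) := Metric.ball 0 1

/-- `L(x) = √(1 - ‖x‖²)`. -/
def L {d : ℕ} (x : E d) : ℝ := Real.sqrt (1 - ‖x‖ ^ 2)

/-- The action `A · x` of `A ∈ O_+(d,1)` on the Klein ball model: `A (x, 1)` is a positive
multiple of `(A · x, 1)`. -/
def klein {d : ℕ} (A : OPlus d) (x : E d) : E d := (A.1 (x, 1)).2⁻¹ • (A.1 (x, 1)).1

/-- The function `(A, v) h` on `B^d` whose graph is the image of the graph of `h` under the
isometry `(A, v)` of co-Minkowski space `B^d × ℝ`. -/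
def act {d : ℕ} (A : OPlus d) (v : V d) (h : E d → ℝ) (x : E d) : ℝ :=
  L x / L (klein A⁻¹ x) * h (klein A⁻¹ x) + inner ℝ x v.1 - v.2

/-- `h : B^d → ℝ` is `τ`-equivariant: it is continuous and `(A, τ(A)) h = h` for all `A ∈ Γ`.
Only the values of `h` on `B^d` matter. -/
def IsEquivariant {d : ℕ} {Γ : Subgroup (OPlus d)} (τ : Z1 Γ) (h : E d → ℝ) : Prop :=
  ContinuousOn h (B d) ∧ ∀ A : Γ, ∀ x ∈ B d, act A.1 (τ.1 A) h x = h x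

/-- Convergence on `B^d`, uniform on compact subsets, of the functions `f n` to `g` and of
their second partial derivatives to those of `g`. -/
def ConvergesWithSecondDerivs {d : ℕ} (f : ℕ → E d → ℝ) (g : E d → ℝ) : Prop :=
  TendstoLocallyUniformlyOn f g atTop (B d) ∧
    TendstoLocallyUniformlyOn (fun n => iteratedFDeriv ℝ 2 (f n)) (iteratedFDeriv ℝ 2 g)
      atTop (B d)

end

end CoMinkowski

namespace CoMinkowski

/-! Each cocycle value gives an affine function `f_A(x) = mink (x, 1) (τ A)`. The cocycle relation
says that the action of `(A', τ A')` sends `f_A` to `f_{A'A}` (`mink_klein`). A weighted average of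
the `f_A`, with weights the Γ-translates of one bump function divided by their sum, is therefore a
smooth equivariant function (`IsWeight.act_average`). Cocompactness makes the translates of the bump
cover the ball, and proper discontinuity makes all the sums locally finite.

The average need not be convex. The function `L` satisfies the equivariance relation for the zero
cocycle, so subtracting `c * L` keeps equivariance (`act_sub_mul_L`), and `-L` has Hessian at least
the Euclidean metric (`hessian_L_le`). On a closed ball that meets every orbit, the Hessian of the
average is bounded by some `c τ`, so `average ψ τ - c τ * L` has nonnegative Hessian there. At any
other point the Hessian of an equivariant function is a positive multiple of the one at a point of
that closed ball, up to a change of vector (`hessian_eq_of_act_eq`). Hence the difference is convex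
on the whole ball.

Continuity in `τ`: near each point the average is `ℓ_τ ∘ Φ`, with `Φ` smooth and independent of `τ`,
and `ℓ_τ` a linear form depending continuously on finitely many values of `τ`. The constant `c τ` is
a multiple of the norm of such a form, so it is continuous too. The concave case follows by applying
the convex one to `-τ` and changing sign. -/

/-! ### The ball, the hyperboloid and the projective action -/

theorem mem_B {d : ℕ} {x : E d} : x ∈ B d ↔ ‖x‖ < 1 := mem_ball_zero_iff

theorem isOpen_B (d : ℕ) : IsOpen (B d) := Metric.isOpen_ball

theorem mem_B_of_mem_closedBall {d : ℕ} {r : ℝ} (hr : r < 1) {x : E d}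
    (hx : x ∈ Metric.closedBall (0 : E d) r) : x ∈ B d :=
  mem_B.2 ((mem_closedBall_zero_iff.1 hx).trans_lt hr)

theorem one_sub_norm_sq_pos {d : ℕ} {x : E d} (hx : x ∈ B d) : 0 < 1 - ‖x‖ ^ 2 := by
  have := mem_B.1 hx
  nlinarith [norm_nonneg x]

theorem L_pos {d : ℕ} {x : E d} (hx : x ∈ B d) : 0 < L x :=
  Real.sqrt_pos.2 (one_sub_norm_sq_pos hx)

theorem L_sq {d : ℕ} {x : E d} (hx : x ∈ B d) : L x ^ 2 = 1 - ‖x‖ ^ 2 :=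
  Real.sq_sqrt (one_sub_norm_sq_pos hx).le

theorem mink_self {d : ℕ} (p : V d) : mink p p = ‖p.1‖ ^ 2 - p.2 ^ 2 := by
  rw [mink, real_inner_self_eq_norm_sq]; ring

theorem mink_smul_left {d : ℕ} (c : ℝ) (p q : V d) : mink (c • p) q = c * mink p q := by
  simp only [mink, Prod.smul_fst, Prod.smul_snd, real_inner_smul_left, smul_eq_mul]; ring

theorem mink_add_right {d : ℕ} (p q s : V d) : mink p (q + s) = mink p q + mink p s := by
  simp only [mink, Prod.fst_add, Prod.snd_add, inner_add_right]; ring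

/-- The central projection of `x ∈ B^d` to the hyperboloid. -/
theorem lift_mem {d : ℕ} {x : E d} (hx : x ∈ B d) :
    (L x)⁻¹ • ((x, 1) : V d) ∈ hyperboloid d := by
  have h := L_pos hx
  refine ⟨?_, by simpa using h⟩
  rw [mink_self]
  simp only [Prod.smul_fst, Prod.smul_snd, norm_smul, smul_eq_mul, mul_one, norm_inv,
    Real.norm_eq_abs, abs_of_pos h, mul_pow, inv_pow]
  have h2 := L_sq hx
  have h3 : L x ^ 2 ≠ 0 := (pow_pos h 2).ne'
  field_simp
  linarith

theorem apply_mem_hyperboloid {d : ℕ} (A : OPlus d) {p : V d} (hp : p ∈ hyperboloid d) :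
    A.1 p ∈ hyperboloid d :=
  A.2.2.subset (Set.mem_image_of_mem A.1 hp)

theorem apply_snd_pos {d : ℕ} (A : OPlus d) {x : E d} (hx : x ∈ B d) : 0 < (A.1 (x, 1)).2 := by
  have h := (apply_mem_hyperboloid A (lift_mem hx)).2
  rw [map_smul, Prod.smul_snd, smul_eq_mul] at h
  exact pos_of_mul_pos_right h (inv_nonneg.2 (L_pos hx).le)

theorem apply_eq_smul {d : ℕ} (A : OPlus d) {x : E d} (hx : x ∈ B d) :
    A.1 (x, 1) = (A.1 (x, 1)).2 • ((klein A x, 1) : V d) := by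
  have h := (apply_snd_pos A hx).ne'
  ext1
  · simp only [klein, Prod.smul_fst]
    rw [smul_inv_smul₀ h]
  · simp

theorem sq_mul_one_sub_norm_klein_sq {d : ℕ} (A : OPlus d) {x : E d} (hx : x ∈ B d) :
    (A.1 (x, 1)).2 ^ 2 * (1 - ‖klein A x‖ ^ 2) = 1 - ‖x‖ ^ 2 := by
  have h := A.2.1 (x, 1) (x, 1)
  rw [mink_self, mink_self, apply_eq_smul A hx] at h
  simp only [Prod.smul_fst, Prod.smul_snd, norm_smul, smul_eq_mul, mul_one, mul_pow,
    Real.norm_eq_abs, sq_abs] at h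
  linarith

theorem klein_mem {d : ℕ} (A : OPlus d) {x : E d} (hx : x ∈ B d) : klein A x ∈ B d := by
  have h := sq_mul_one_sub_norm_klein_sq A hx
  have h1 := one_sub_norm_sq_pos hx
  rw [← h] at h1
  have h2 := pos_of_mul_pos_right h1 (sq_nonneg _)
  rw [mem_B]
  nlinarith [norm_nonneg (klein A x)]

theorem L_eq_mul_L_klein {d : ℕ} (A : OPlus d) {x : E d} (hx : x ∈ B d) :
    L x = (A.1 (x, 1)).2 * L (klein A x) := by
  rw [L, L, ← sq_mul_one_sub_norm_klein_sq A hx, Real.sqrt_mul (sq_nonneg _),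
    Real.sqrt_sq (apply_snd_pos A hx).le]

/-- The factor in `act` is the last coordinate of `A (x, 1)`, hence affine in `x`. This is what
makes the action projective and lets it send affine functions to affine functions. -/
theorem L_div_L_klein {d : ℕ} (A : OPlus d) {x : E d} (hx : x ∈ B d) :
    L x / L (klein A x) = (A.1 (x, 1)).2 := by
  rw [div_eq_iff (L_pos (klein_mem A hx)).ne', L_eq_mul_L_klein A hx]

theorem klein_smul {d : ℕ} {A : OPlus d} {p : V d} {c : ℝ} {y : E d} (hc : c ≠ 0)
    (h : p = c • ((y, 1) : V d)) : (A.1 p).2⁻¹ • (A.1 p).1 = klein A y := by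
  rw [h, map_smul, Prod.smul_snd, Prod.smul_fst, smul_smul, klein, smul_eq_mul, mul_inv,
    mul_right_comm, inv_mul_cancel₀ hc, one_mul]

theorem klein_klein {d : ℕ} (A A' : OPlus d) {x : E d} (hx : x ∈ B d) :
    klein A (klein A' x) = klein (A * A') x :=
  (klein_smul (apply_snd_pos A' hx).ne' (apply_eq_smul A' hx)).symm

/-- The central projection of the hyperboloid to the ball. -/
theorem proj_mem {d : ℕ} {p : V d} (hp : p ∈ hyperboloid d) : p.2⁻¹ • p.1 ∈ B d := by
  have h1 := hp.1
  have h2 := hp.2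
  rw [mink_self] at h1
  rw [mem_B, norm_smul, norm_inv, Real.norm_eq_abs, abs_of_pos h2, inv_mul_lt_iff₀ h2, mul_one]
  nlinarith [norm_nonneg p.1]

theorem klein_proj {d : ℕ} (A : OPlus d) {p : V d} (hp : p ∈ hyperboloid d) :
    klein A (p.2⁻¹ • p.1) = (A.1 p).2⁻¹ • (A.1 p).1 := by
  refine (klein_smul hp.2.ne' ?_).symm
  ext1
  · simp only [Prod.smul_fst]
    rw [smul_inv_smul₀ hp.2.ne']
  · simp

theorem proj_lift {d : ℕ} {x : E d} (hx : x ∈ B d) :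
    ((L x)⁻¹ • ((x, 1) : V d)).2⁻¹ • ((L x)⁻¹ • ((x, 1) : V d)).1 = x := by
  have h := (L_pos hx).ne'
  simp only [Prod.smul_fst, Prod.smul_snd, smul_eq_mul, mul_one, inv_inv]
  rw [smul_inv_smul₀ h]

/-! ### Cocompactness and proper discontinuity seen in the ball -/

theorem continuous_apply {d : ℕ} (A : OPlus d) : Continuous A.1 :=
  LinearMap.continuous_of_finiteDimensional A.1.toLinearMap

instance {d : ℕ} (Γ : Subgroup (OPlus d)) : ContinuousConstSMul Γ (hyperboloid d) where
  continuous_const_smul A :=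
    ((continuous_apply A.1).comp continuous_subtype_val).subtype_mk _

theorem continuous_proj (d : ℕ) :
    Continuous fun p : hyperboloid d => p.1.2⁻¹ • p.1.1 := by
  have h2 : Continuous fun p : hyperboloid d => p.1.2 := by fun_prop
  have h1 : Continuous fun p : hyperboloid d => p.1.1 := by fun_prop
  exact (h2.inv₀ fun p => p.2.2.ne').smul h1

/-- A cocompact group moves every point of the ball into a fixed smaller ball. -/
theorem exists_radius {d : ℕ} {Γ : Subgroup (OPlus d)} (hΓ : IsCompactHyperbolicManifold Γ) :
    ∃ r : ℝ, 0 < r ∧ r < 1 ∧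
      ∀ x ∈ B d, ∃ A : Γ, klein A.1⁻¹ x ∈ Metric.closedBall (0 : E d) r := by
  have := hΓ.compact_quotient
  -- The shift by 2 makes already the first radius, 1/2, positive.
  let ρ : ℕ → ℝ := fun n => 1 - 1 / ((n : ℝ) + 2)
  let U : ℕ → Set (hyperboloid d) := fun n => {p | ‖p.1.2⁻¹ • p.1.1‖ < ρ n}
  have hUo : ∀ n, IsOpen (U n) := fun n =>
    isOpen_lt (continuous_norm.comp (continuous_proj d)) continuous_const
  let q : hyperboloid d → MulAction.orbitRel.Quotient Γ (hyperboloid d) := Quotient.mk _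
  have hq : IsOpenMap q := isOpenMap_quotient_mk'_mul
  have hρ : Monotone ρ := by
    intro m n hmn
    have : (m : ℝ) ≤ n := by exact_mod_cast hmn
    simp only [ρ]
    gcongr
  have hcov : (univ : Set (MulAction.orbitRel.Quotient Γ (hyperboloid d))) ⊆
      ⋃ n, q '' U n := by
    rintro a -
    induction a using Quotient.inductionOn with
    | h p =>
      have hp := mem_B.1 (proj_mem p.2)
      obtain ⟨n, hn⟩ := exists_nat_one_div_lt (sub_pos.2 hp)
      refine mem_iUnion.2 ⟨n, p, ?_, rfl⟩
      have : 1 / ((n : ℝ) + 2) ≤ 1 / ((n : ℝ) + 1) := by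
        gcongr; norm_num
      simp only [U, ρ, mem_ofPred_eq]
      linarith
  obtain ⟨n, hn⟩ := isCompact_univ.elim_directed_cover (fun n => q '' U n)
    (fun n => hq _ (hUo n)) hcov
    (directed_of_isDirected_le fun m n hmn =>
      image_mono fun p (hp : _ < _) => hp.trans_le (hρ hmn))
  have hn2 : (0 : ℝ) < (n : ℝ) + 2 := by positivity
  refine ⟨ρ n, ?_, ?_, fun x hx => ?_⟩
  · simp only [ρ]
    rw [sub_pos, div_lt_one hn2]
    linarith [n.cast_nonneg (α := ℝ)]
  · simp only [ρ]
    linarith [one_div_pos.2 hn2]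
  · obtain ⟨p, hp, hpx⟩ := hn (mem_univ (q ⟨_, lift_mem hx⟩))
    obtain ⟨A, hA⟩ := MulAction.orbitRel_apply.1 (Quotient.exact hpx)
    -- The orbit relation gives `A` carrying the lift of `x` to `p`, while the claim involves the
    -- inverse of the witness.
    refine ⟨A⁻¹, ?_⟩
    have h1 := klein_proj A.1 (lift_mem hx)
    rw [proj_lift hx] at h1
    have h2 : A.1.1 ((L x)⁻¹ • ((x, 1) : V d)) = p.1 := congrArg Subtype.val hA
    rw [h2] at h1
    rw [mem_closedBall_zero_iff, InvMemClass.coe_inv, inv_inv, h1]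
    exact le_of_lt hp

/-- The part of the hyperboloid over a closed ball of radius `r < 1` is compact. -/
theorem isCompact_over_closedBall {d : ℕ} {r : ℝ} (hr : r < 1) :
    IsCompact {p : hyperboloid d | p.1.2⁻¹ • p.1.1 ∈ Metric.closedBall (0 : E d) r} := by
  have hB := isCompact_closedBall (0 : E d) r
  have hlift : ContinuousOn (fun x : E d => (L x)⁻¹ • ((x, 1) : V d))
      (Metric.closedBall (0 : E d) r) := by
    refine ContinuousOn.smul (ContinuousOn.inv₀ ?_ fun x hx =>
      (L_pos (mem_B_of_mem_closedBall hr hx)).ne') (by fun_prop)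
    exact Continuous.continuousOn (by unfold L; fun_prop)
  rw [Subtype.isCompact_iff]
  convert hB.image_of_continuousOn hlift using 1
  ext p
  constructor
  · rintro ⟨p, hp, rfl⟩
    refine ⟨_, hp, ?_⟩
    have h1 := p.2.1
    have h2 := p.2.2
    have h3 : L (p.1.2⁻¹ • p.1.1) = p.1.2⁻¹ := by
      rw [mink_self] at h1
      rw [L, Real.sqrt_eq_iff_mul_self_eq_of_pos (inv_pos.2 h2), norm_smul, norm_inv,
        Real.norm_eq_abs, abs_of_pos h2]
      field_simp
      linarith
    simp only [h3, inv_inv]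
    ext1
    · simp only [Prod.smul_fst]
      rw [smul_inv_smul₀ h2.ne']
    · simp
  · rintro ⟨x, hx, rfl⟩
    refine ⟨⟨_, lift_mem (mem_B_of_mem_closedBall hr hx)⟩, ?_, rfl⟩
    rw [mem_ofPred_eq, proj_lift (mem_B_of_mem_closedBall hr hx)]
    exact hx

theorem finite_klein_meets {d : ℕ} {Γ : Subgroup (OPlus d)}
    (hΓ : IsCompactHyperbolicManifold Γ) {r s : ℝ} (hr : r < 1) (hs : s < 1) :
    {A : Γ | ∃ x ∈ Metric.closedBall (0 : E d) s,
      klein A.1⁻¹ x ∈ Metric.closedBall (0 : E d) r}.Finite := by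
  have := hΓ.properlyDiscontinuous
  refine (ProperlyDiscontinuousSMul.finite_disjoint_inter_image (Γ := Γ)
    (isCompact_over_closedBall (d := d) hr) (isCompact_over_closedBall (d := d) hs)).subset ?_
  rintro A ⟨x, hx, hAx⟩
  have hxB := mem_B_of_mem_closedBall hs hx
  let p : hyperboloid d := ⟨_, lift_mem hxB⟩
  refine ⟨p, ⟨A⁻¹ • p, ?_, smul_inv_smul A p⟩, ?_⟩
  · have h1 := klein_proj A.1⁻¹ p.2
    rw [proj_lift hxB] at h1
    rw [h1] at hAx
    exact hAx
  · rw [mem_ofPred_eq, proj_lift hxB]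
    exact hx

theorem contDiffOn_klein {d : ℕ} (A : OPlus d) : ContDiffOn ℝ ∞ (klein A) (B d) := by
  have h : ContDiff ℝ ∞ fun x : E d => A.1 (x, 1) :=
    (LinearMap.toContinuousLinearMap A.1.toLinearMap).contDiff.comp
      (contDiff_id.prodMk contDiff_const)
  exact (h.snd.contDiffOn.inv fun x hx => (apply_snd_pos A hx).ne').smul h.fst.contDiffOn

theorem contDiffOn_L (d : ℕ) : ContDiffOn ℝ ∞ (L (d := d)) (B d) :=
  ContDiffOn.sqrt (contDiff_const.sub (contDiff_norm_sq ℝ)).contDiffOn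
    fun _ hx => (one_sub_norm_sq_pos hx).ne'

/-! ### Hessians along lines and locally uniform convergence -/

section Calculus

theorem two_le_infty : ((2 : ℕ) : WithTop ℕ∞) ≤ ∞ :=
  WithTop.coe_le_coe.2 le_top

variable {X Z : Type*} [NormedAddCommGroup X] [NormedSpace ℝ X]
  [NormedAddCommGroup Z] [NormedSpace ℝ Z]

theorem hasDerivAt_line (x w : X) (t : ℝ) : HasDerivAt (fun s : ℝ => x + s • w) w t := by
  simpa using ((hasDerivAt_id t).smul_const w).const_add x

theorem hasDerivAt_comp_line {h : X → Z} {U : Set X} (hU : IsOpen U) (hh : ContDiffOn ℝ ∞ h U)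
    {x w : X} {t : ℝ} (ht : x + t • w ∈ U) :
    HasDerivAt (fun s : ℝ => h (x + s • w)) (fderiv ℝ h (x + t • w) w) t :=
  HasFDerivAt.comp_hasDerivAt (f := fun s : ℝ => x + s • w) t
    ((hh.contDiffAt (hU.mem_nhds ht)).differentiableAt (by simp)).hasFDerivAt
    (hasDerivAt_line x w t)

theorem hasDerivAt_fderiv_comp_line {h : X → Z} {U : Set X} (hU : IsOpen U)
    (hh : ContDiffOn ℝ ∞ h U) {x w : X} {t : ℝ} (ht : x + t • w ∈ U) :
    HasDerivAt (fun s : ℝ => fderiv ℝ h (x + s • w) w)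
      (fderiv ℝ (fderiv ℝ h) (x + t • w) w w) t :=
  (hasDerivAt_comp_line hU (hh.fderiv_of_isOpen (m := ∞) hU (by simp)) ht).clm_apply
    (hasDerivAt_const t w) |>.congr_deriv (by simp)

/-- A smooth function on an open convex set with nonnegative Hessian is convex. -/
theorem convexOn_of_fderiv_fderiv_nonneg {h : X → ℝ} {U : Set X} (hU : IsOpen U)
    (hUc : Convex ℝ U) (hh : ContDiffOn ℝ ∞ h U)
    (hpos : ∀ x ∈ U, ∀ w, 0 ≤ fderiv ℝ (fderiv ℝ h) x w w) : ConvexOn ℝ U h := by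
  refine ⟨hUc, fun x hx y hy a b ha hb hab => ?_⟩
  have hmem : ∀ t ∈ Icc (0 : ℝ) 1, x + t • (y - x) ∈ U := fun t ht =>
    hUc.add_smul_sub_mem hx hy ht
  have hc : ConvexOn ℝ (Icc (0 : ℝ) 1) fun t => h (x + t • (y - x)) := by
    refine convexOn_of_hasDerivWithinAt2_nonneg (convex_Icc 0 1)
      (fun t ht => (hasDerivAt_comp_line hU hh (hmem t ht)).continuousAt.continuousWithinAt)
      (fun t ht => (hasDerivAt_comp_line hU hh (hmem t (interior_subset ht))).hasDerivWithinAt)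
      (fun t ht =>
        (hasDerivAt_fderiv_comp_line hU hh (hmem t (interior_subset ht))).hasDerivWithinAt)
      fun t ht => hpos _ (hmem t (interior_subset ht)) _
  have h2 := hc.2 (left_mem_Icc.2 zero_le_one) (right_mem_Icc.2 zero_le_one) ha hb hab
  have h3 : x + b • (y - x) = a • x + b • y := by
    rw [← eq_sub_iff_add_eq] at hab
    rw [hab]; module
  simpa [h3] using h2

/-- Invariance of the second derivative under a projective change of parameter. -/
theorem second_deriv_projective {g k g₁ k₁ : ℝ → ℝ} {a α b c g₂ k₂ : ℝ} (ha : 0 < a)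
    (hgk : ∀ᶠ t in 𝓝 0, g t = (a + α * t) * k (t / (a + α * t)) + (b + c * t))
    (hg : ∀ᶠ t in 𝓝 0, HasDerivAt g (g₁ t) t) (hg₁ : HasDerivAt g₁ g₂ 0)
    (hk : ∀ᶠ t in 𝓝 0, HasDerivAt k (k₁ t) t) (hk₁ : HasDerivAt k₁ k₂ 0) : g₂ = k₂ / a := by
  have hl : ∀ t : ℝ, HasDerivAt (fun t => a + α * t) α t := fun t => by
    simpa using ((hasDerivAt_id t).const_mul α).const_add a
  have hl' : ∀ t : ℝ, HasDerivAt (fun t => b + c * t) c t := fun t => by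
    simpa using ((hasDerivAt_id t).const_mul c).const_add b
  have hne : ∀ᶠ t in 𝓝 (0 : ℝ), a + α * t ≠ 0 :=
    (hl 0).continuousAt.eventually_ne (by simpa using ha.ne')
  have hu : ∀ t, a + α * t ≠ 0 →
      HasDerivAt (fun t => t / (a + α * t)) (a / (a + α * t) ^ 2) t := fun t ht =>
    ((hasDerivAt_id t).div (hl t) ht).congr_deriv (by simp; ring)
  have hu0 : Tendsto (fun t => t / (a + α * t)) (𝓝 0) (𝓝 0) := by
    have := (hu 0 (by simpa using ha.ne')).continuousAt.tendsto
    simpa using this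
  -- With `u = t / (a + α t)` one has `u' = a / (a + α t)²`, so one factor `a + α t` cancels. On
  -- differentiating once more at 0, the two terms `± α * k₁ 0 / a` cancel and only `k₂ / a`
  -- remains.
  have h1 : g₁ =ᶠ[𝓝 0] fun t => α * k (t / (a + α * t))
      + a * (k₁ (t / (a + α * t)) / (a + α * t)) + c := by
    filter_upwards [hgk.eventually_nhds, hg, hne, hu0.eventually hk] with t h1 h2 h3 h4
    have h5 := ((hl t).mul (h4.comp t (hu t h3))).add (hl' t)
    refine h2.unique (h5.congr_of_eventuallyEq h1 |>.congr_deriv ?_)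
    simp only [Function.comp_apply]
    field_simp
  have h0 : (0 : ℝ) / (a + α * 0) = 0 := by simp
  have hne0 : a + α * 0 ≠ 0 := by simpa using ha.ne'
  have hk0 : HasDerivAt k (k₁ 0) (0 / (a + α * 0)) := by
    rw [h0]; exact hk.self_of_nhds
  have hk10 : HasDerivAt k₁ k₂ (0 / (a + α * 0)) := by
    rw [h0]; exact hk₁
  have h6 := (((hk0.comp 0 (hu 0 hne0)).const_mul α).add
    (((hk10.comp 0 (hu 0 hne0)).div (hl 0) hne0).const_mul a)).add_const c
  refine hg₁.unique (h6.congr_of_eventuallyEq h1 |>.congr_deriv ?_)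
  simp only [Function.comp_apply, h0]
  field_simp
  ring

theorem fderiv_fderiv_clm_comp {Φ : X → Z} {U : Set X} (hU : IsOpen U)
    (hΦ : ContDiffOn ℝ ∞ Φ U) (ℓ : Z →L[ℝ] ℝ) {x : X} (hx : x ∈ U) (w : X) :
    fderiv ℝ (fderiv ℝ fun y => ℓ (Φ y)) x w w = ℓ (fderiv ℝ (fderiv ℝ Φ) x w w) := by
  have hx0 : x + (0 : ℝ) • w ∈ U := by simpa using hx
  have h1 := hasDerivAt_fderiv_comp_line hU (ℓ.contDiff.comp_contDiffOn hΦ) hx0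
  have h2 := ℓ.hasFDerivAt.comp_hasDerivAt 0 (hasDerivAt_fderiv_comp_line hU hΦ hx0)
  simp only [zero_smul, add_zero] at h1 h2
  refine h1.unique (h2.congr_of_eventuallyEq ?_)
  have : ∀ᶠ t : ℝ in 𝓝 0, x + t • w ∈ U :=
    (hasDerivAt_line x w 0).continuousAt.eventually_mem (hU.mem_nhds hx0)
  filter_upwards [this] with t ht
  exact (hasDerivAt_comp_line hU (ℓ.contDiff.comp_contDiffOn hΦ) ht).unique
    (ℓ.hasFDerivAt.comp_hasDerivAt t (hasDerivAt_comp_line hU hΦ ht))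

/-- The Hessians of the functions `ℓ ∘ Φ` are bounded by a multiple of `‖ℓ‖` on compact sets. -/
theorem exists_hessian_bound {Φ : X → Z} {U K : Set X} (hU : IsOpen U)
    (hΦ : ContDiffOn ℝ ∞ Φ U) (hK : IsCompact K) (hKU : K ⊆ U) :
    ∃ C : ℝ, 0 ≤ C ∧ ∀ ℓ : Z →L[ℝ] ℝ, ∀ x ∈ K, ∀ w,
      |fderiv ℝ (fderiv ℝ fun y => ℓ (Φ y)) x w w| ≤ C * ‖ℓ‖ * ‖w‖ ^ 2 := by
  have hc : ContinuousOn (fderiv ℝ (fderiv ℝ Φ)) U :=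
    ((hΦ.fderiv_of_isOpen (m := ∞) hU (by simp)).fderiv_of_isOpen (m := ∞) hU
      (by simp)).continuousOn
  obtain ⟨C, hC⟩ := hK.exists_bound_of_continuousOn (E := X →L[ℝ] X →L[ℝ] Z) (hc.mono hKU)
  refine ⟨max C 0, le_max_right _ _, fun ℓ x hx w => ?_⟩
  rw [fderiv_fderiv_clm_comp hU hΦ ℓ (hKU hx), ← Real.norm_eq_abs]
  calc ‖ℓ (fderiv ℝ (fderiv ℝ Φ) x w w)‖ ≤ ‖ℓ‖ * (‖fderiv ℝ (fderiv ℝ Φ) x‖ * ‖w‖ * ‖w‖) :=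
        ℓ.le_opNorm_of_le (ContinuousLinearMap.le_opNorm₂ _ _ _)
    _ ≤ ‖ℓ‖ * (max C 0 * ‖w‖ * ‖w‖) := by
        gcongr
        exact (hC x hx).trans (le_max_left _ _)
    _ = max C 0 * ‖ℓ‖ * ‖w‖ ^ 2 := by ring

theorem tendsto_clm_apply {ι : Type*} {p : Filter ι} {ℓ : ι → X →L[ℝ] Z} {ℓ' : X →L[ℝ] Z}
    {u : ι → X} {u' : X} (hℓ : Tendsto ℓ p (𝓝 ℓ')) (hu : Tendsto u p (𝓝 u')) :
    Tendsto (fun i => ℓ i (u i)) p (𝓝 (ℓ' u')) :=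
  (isBoundedBilinearMap_apply.continuous.tendsto (ℓ', u')).comp (hℓ.prodMk_nhds hu)

theorem iteratedFDeriv_clm_comp {Φ : X → Z} {U : Set X} (hU : IsOpen U)
    (hΦ : ContDiffOn ℝ ∞ Φ U) (ℓ : Z →L[ℝ] ℝ) {x : X} (hx : x ∈ U) :
    iteratedFDeriv ℝ 2 (fun y => ℓ (Φ y)) x
      = ℓ.compContinuousMultilinearMap (iteratedFDeriv ℝ 2 Φ x) :=
  ℓ.iteratedFDeriv_comp_left (hΦ.contDiffAt (hU.mem_nhds hx)) two_le_infty

/-- Joint convergence in the index and the point, together with continuity of the limit, puts the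
pairs `(f y, F i y)` near the diagonal point `(f x, f x)`, hence in any given entourage. -/
theorem tendstoLocallyUniformlyOn_of_tendsto {ι Y X : Type*} [TopologicalSpace X]
    [SeminormedAddCommGroup Y] {p : Filter ι} {F : ι → X → Y} {f : X → Y} {s : Set X} (hf : ContinuousOn f s)
    (h : ∀ x ∈ s, Tendsto (fun y : ι × X => F y.1 y.2) (p ×ˢ 𝓝[s] x) (𝓝 (f x))) :
    TendstoLocallyUniformlyOn F f p s := by
  rw [tendstoLocallyUniformlyOn_iff_forall_tendsto]
  intro x hx
  have h1 : Tendsto (fun y : ι × X => f y.2) (p ×ˢ 𝓝[s] x) (𝓝 (f x)) :=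
    (hf x hx).tendsto.comp tendsto_snd
  exact (h1.prodMk_nhds (h x hx)).mono_right (nhds_le_uniformity _)

end Calculus

/-- Functions that depend linearly on their coefficients, locally with finitely many of them,
converge with their second derivatives when the coefficients do. -/
theorem convergesWithSecondDerivs_of_locally_linear {d : ℕ} {f : ℕ → E d → ℝ} {g : E d → ℝ}
    (H : ∀ x ∈ B d, ∃ (Z : Type) (_ : NormedAddCommGroup Z) (_ : NormedSpace ℝ Z) (U : Set (E d))
      (Φ : E d → Z) (ℓ : ℕ → Z →L[ℝ] ℝ) (ℓ' : Z →L[ℝ] ℝ), IsOpen U ∧ x ∈ U ∧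
        ContDiffOn ℝ ∞ Φ U ∧ Tendsto ℓ atTop (𝓝 ℓ') ∧
        (∀ n, ∀ y ∈ U, f n y = ℓ n (Φ y)) ∧ ∀ y ∈ U, g y = ℓ' (Φ y)) :
    ConvergesWithSecondDerivs f g := by
  constructor
  · refine tendstoLocallyUniformlyOn_of_tendsto ?_ ?_
    · intro x hx
      obtain ⟨Z, _, _, U, Φ, ℓ, ℓ', hU, hxU, hΦ, -, -, hg⟩ := H x hx
      refine ContinuousAt.continuousWithinAt ?_
      refine ContinuousAt.congr (f := fun y => ℓ' (Φ y)) ?_ ?_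
      · exact ℓ'.continuous.continuousAt.comp (hΦ.continuousOn.continuousAt (hU.mem_nhds hxU))
      · filter_upwards [hU.mem_nhds hxU] with y hy using (hg y hy).symm
    · intro x hx
      obtain ⟨Z, _, _, U, Φ, ℓ, ℓ', hU, hxU, hΦ, hℓ, hf, hg⟩ := H x hx
      rw [hg x hxU]
      have h1 : Tendsto (fun y : ℕ × E d => ℓ y.1 (Φ y.2)) (atTop ×ˢ 𝓝 x) (𝓝 (ℓ' (Φ x))) :=
        tendsto_clm_apply (hℓ.comp tendsto_fst)
          ((hΦ.continuousOn.continuousAt (hU.mem_nhds hxU)).tendsto.comp tendsto_snd)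
      refine Tendsto.mono_left (h1.congr' ?_) (Filter.prod_mono le_rfl nhdsWithin_le_nhds)
      filter_upwards [tendsto_snd.eventually (hU.mem_nhds hxU)] with y hy
      exact (hf _ _ hy).symm
  · have hcont : ∀ {Z : Type} [NormedAddCommGroup Z] [NormedSpace ℝ Z] {U : Set (E d)}
        {Φ : E d → Z} {x : E d}, IsOpen U → ContDiffOn ℝ ∞ Φ U → x ∈ U →
        ContinuousAt (iteratedFDeriv ℝ 2 Φ) x := fun {Z} _ _ {U Φ x} hU hΦ hx =>
      (hΦ.contDiffAt (hU.mem_nhds hx)).continuousAt_iteratedFDeriv two_le_infty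
    have heq : ∀ {Z : Type} [NormedAddCommGroup Z] [NormedSpace ℝ Z] {U : Set (E d)}
        {Φ : E d → Z} {ℓ : Z →L[ℝ] ℝ} {g : E d → ℝ}, IsOpen U → ContDiffOn ℝ ∞ Φ U →
        (∀ y ∈ U, g y = ℓ (Φ y)) → ∀ y ∈ U, iteratedFDeriv ℝ 2 g y
          = ContinuousLinearMap.compContinuousMultilinearMapL ℝ (fun _ : Fin 2 => E d) Z ℝ ℓ
            (iteratedFDeriv ℝ 2 Φ y) := fun {Z} _ _ {U Φ ℓ g} hU hΦ hg y hy => by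
      have h1 : g =ᶠ[𝓝 y] fun y => ℓ (Φ y) := by
        filter_upwards [hU.mem_nhds hy] with z hz using hg z hz
      rw [(h1.iteratedFDeriv ℝ 2).self_of_nhds, iteratedFDeriv_clm_comp hU hΦ ℓ hy]
      rfl
    refine tendstoLocallyUniformlyOn_of_tendsto ?_ ?_
    · intro x hx
      obtain ⟨Z, _, _, U, Φ, ℓ, ℓ', hU, hxU, hΦ, -, -, hg⟩ := H x hx
      refine ContinuousAt.continuousWithinAt ?_
      refine ContinuousAt.congr (f := fun y =>
        ContinuousLinearMap.compContinuousMultilinearMapL ℝ (fun _ : Fin 2 => E d) Z ℝ ℓ'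
          (iteratedFDeriv ℝ 2 Φ y)) ?_ ?_
      · exact (ContinuousLinearMap.continuous _).continuousAt.comp (hcont hU hΦ hxU)
      · filter_upwards [hU.mem_nhds hxU] with y hy using (heq hU hΦ hg y hy).symm
    · intro x hx
      obtain ⟨Z, _, _, U, Φ, ℓ, ℓ', hU, hxU, hΦ, hℓ, hf, hg⟩ := H x hx
      rw [heq hU hΦ hg x hxU]
      have h1 : Tendsto (fun y : ℕ × E d =>
          ContinuousLinearMap.compContinuousMultilinearMapL ℝ (fun _ : Fin 2 => E d) Z ℝ (ℓ y.1)
            (iteratedFDeriv ℝ 2 Φ y.2)) (atTop ×ˢ 𝓝 x)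
          (𝓝 (ContinuousLinearMap.compContinuousMultilinearMapL ℝ (fun _ : Fin 2 => E d) Z ℝ ℓ'
            (iteratedFDeriv ℝ 2 Φ x))) :=
        tendsto_clm_apply
          (((ContinuousLinearMap.continuous _).tendsto _).comp (hℓ.comp tendsto_fst))
          ((hcont hU hΦ hxU).tendsto.comp tendsto_snd)
      refine Tendsto.mono_left (h1.congr' ?_) (Filter.prod_mono le_rfl nhdsWithin_le_nhds)
      filter_upwards [tendsto_snd.eventually (hU.mem_nhds hxU)] with y hy
      exact (heq hU hΦ (hf _) _ hy).symm

/-! ### Hessians of `L` and of invariant functions -/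

theorem fderiv_fderiv_sub_mul {X : Type*} [NormedAddCommGroup X] [NormedSpace ℝ X]
    {f g : X → ℝ} {U : Set X} (hU : IsOpen U) (hf : ContDiffOn ℝ ∞ f U)
    (hg : ContDiffOn ℝ ∞ g U) (c : ℝ) {x : X} (hx : x ∈ U) (w : X) :
    fderiv ℝ (fderiv ℝ fun y => f y - c * g y) x w w
      = fderiv ℝ (fderiv ℝ f) x w w - c * fderiv ℝ (fderiv ℝ g) x w w :=
  fderiv_fderiv_clm_comp (Φ := fun y => (f y, g y)) hU (hf.prodMk hg)
    (ContinuousLinearMap.fst ℝ ℝ ℝ - c • ContinuousLinearMap.snd ℝ ℝ ℝ) hx w |>.trans (by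
    have hx0 : x + (0 : ℝ) • w ∈ U := by simpa using hx
    have h1 := fderiv_fderiv_clm_comp (Φ := fun y => (f y, g y)) hU (hf.prodMk hg)
      (ContinuousLinearMap.fst ℝ ℝ ℝ) hx w
    have h2 := fderiv_fderiv_clm_comp (Φ := fun y => (f y, g y)) hU (hf.prodMk hg)
      (ContinuousLinearMap.snd ℝ ℝ ℝ) hx w
    simp only [ContinuousLinearMap.coe_fst', ContinuousLinearMap.coe_snd'] at h1 h2
    simp only [sub_apply, smul_apply, ContinuousLinearMap.coe_fst',
      ContinuousLinearMap.coe_snd', smul_eq_mul]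
    rw [← h1, ← h2])

/-- The function `-L`, whose graph is the hyperboloid, is uniformly convex. -/
theorem hessian_L_le {d : ℕ} {x : E d} (hx : x ∈ B d) (w : E d) :
    fderiv ℝ (fderiv ℝ (L (d := d))) x w w ≤ -‖w‖ ^ 2 := by
  have hx0 : x + (0 : ℝ) • w ∈ B d := by simpa using hx
  have hev : ∀ᶠ t : ℝ in 𝓝 0, x + t • w ∈ B d :=
    (hasDerivAt_line x w 0).continuousAt.eventually_mem ((isOpen_B d).mem_nhds hx0)
  have h1 := hasDerivAt_comp_line (isOpen_B d) (contDiffOn_L d) hx0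
  have h2 := hasDerivAt_fderiv_comp_line (isOpen_B d) (contDiffOn_L d) hx0
  -- This is the derivative of `L² = 1 - ‖·‖²` along the line, halved. Differentiating again gives
  -- `L'² + L L'' = -‖w‖²`, and `0 < L ≤ 1` then yields the bound.
  have h3 : (fun t : ℝ => L (x + t • w) * fderiv ℝ L (x + t • w) w)
      =ᶠ[𝓝 0] fun t => -(inner ℝ x w + t * ‖w‖ ^ 2) := by
    filter_upwards [hev.eventually_nhds, hev] with t ht ht'
    have h4 := (hasDerivAt_comp_line (isOpen_B d) (contDiffOn_L d) ht').fun_pow 2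
    have h5 := (((hasDerivAt_line x w t).norm_sq).const_sub 1).congr_of_eventuallyEq
      (ht.mono fun s hs => L_sq hs)
    have h6 := h4.unique h5
    simp only [inner_add_left, real_inner_smul_left, real_inner_self_eq_norm_sq, Nat.cast_ofNat,
      Nat.add_one_sub_one, pow_one] at h6
    linarith
  have h7 := (((hasDerivAt_id (0 : ℝ)).mul_const (‖w‖ ^ 2)).const_add (inner ℝ x w)).neg
  have h8 := (h1.mul h2).unique (h7.congr_of_eventuallyEq h3)
  simp only [zero_smul, add_zero, one_mul] at h8
  have hL := L_pos hx
  have hL1 : L x ≤ 1 := by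
    rw [L, Real.sqrt_le_iff]
    constructor <;> nlinarith [sq_nonneg ‖x‖]
  nlinarith [sq_nonneg (fderiv ℝ L x w), sq_nonneg ‖w‖]

/-- The Hessian of a function invariant under an isometry `(A, v)` of co-Minkowski space at
`x` is a positive multiple of its Hessian at `A⁻¹ · x`. -/
theorem hessian_eq_of_act_eq {d : ℕ} {A : OPlus d} {v : V d} {h : E d → ℝ}
    (hh : ContDiffOn ℝ ∞ h (B d)) (hA : ∀ x ∈ B d, act A v h x = h x) {x : E d} (hx : x ∈ B d)
    (w : E d) : ∃ a : ℝ, 0 < a ∧ ∃ w' : E d, fderiv ℝ (fderiv ℝ h) x w w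
      = fderiv ℝ (fderiv ℝ h) (klein A⁻¹ x) w' w' / a := by
  set y := klein A⁻¹ x with hy
  set a := ((A⁻¹).1 (x, 1)).2 with ha
  set α := ((A⁻¹).1 (w, 0)).2 with hα
  -- Since `A⁻¹ (x + t w, 1) = (a + α t) (y, 1) + t (w', 0)`, the image line is `y + (t / (a + α t))
  -- w'`.
  set w' := ((A⁻¹).1 (w, 0)).1 - α • y with hw'
  have ha0 : 0 < a := apply_snd_pos A⁻¹ hx
  have hyB : y ∈ B d := klein_mem A⁻¹ hx
  have hx0 : x + (0 : ℝ) • w ∈ B d := by simpa using hx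
  have hy0 : y + (0 : ℝ) • w' ∈ B d := by simpa using hyB
  have hev : ∀ {x w : E d}, x + (0 : ℝ) • w ∈ B d → ∀ᶠ t : ℝ in 𝓝 0, x + t • w ∈ B d :=
    fun {x w} h =>
      (hasDerivAt_line x w 0).continuousAt.eventually_mem ((isOpen_B d).mem_nhds h)
  have happ : ∀ t : ℝ, (A⁻¹).1 (x + t • w, 1) = (A⁻¹).1 (x, 1) + t • (A⁻¹).1 (w, 0) := by
    intro t
    rw [← map_smul, ← map_add]
    simp
  have hgk : ∀ᶠ t : ℝ in 𝓝 0, h (x + t • w) = (a + α * t) * h (y + (t / (a + α * t)) • w')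
      + ((inner ℝ x v.1 - v.2) + inner ℝ w v.1 * t) := by
    filter_upwards [hev hx0] with t ht
    have h1 := hA _ ht
    have h2 : ((A⁻¹).1 (x + t • w, 1)).2 = a + α * t := by
      rw [happ]
      simp only [Prod.snd_add, Prod.smul_snd, smul_eq_mul, ← ha, ← hα, mul_comm]
    have h3 : 0 < a + α * t := h2 ▸ apply_snd_pos A⁻¹ ht
    have h4 : klein A⁻¹ (x + t • w) = y + (t / (a + α * t)) • w' := by
      have h5 : ((A⁻¹).1 (x, 1)).1 = a • y := congrArg Prod.fst (apply_eq_smul A⁻¹ hx)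
      have h6 : ((A⁻¹).1 (w, 0)).1 = w' + α • y := by rw [hw']; abel
      rw [klein, h2, inv_smul_eq_iff₀ h3.ne', happ, Prod.fst_add, Prod.smul_fst, h5, h6,
        smul_add (a + α * t), smul_smul, mul_div_cancel₀ _ h3.ne']
      module
    rw [act, L_div_L_klein _ ht, h2, h4, inner_add_left, real_inner_smul_left] at h1
    rw [← h1]
    ring
  refine ⟨a, ha0, w', ?_⟩
  have h7 := hasDerivAt_fderiv_comp_line (isOpen_B d) hh hx0
  have h8 := hasDerivAt_fderiv_comp_line (isOpen_B d) hh hy0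
  have h9 := second_deriv_projective ha0 hgk
    ((hev hx0).mono fun t ht => hasDerivAt_comp_line (isOpen_B d) hh ht) h7
    ((hev hy0).mono fun t ht => hasDerivAt_comp_line (isOpen_B d) hh ht) h8
  simpa using h9

/-! ### Weighted averages of affine functions -/

section Average

variable {d : ℕ} {Γ : Subgroup (OPlus d)}

/-- The translate by `A` of a weight function on the ball. -/
noncomputable def weight (ψ : E d → ℝ) (A : Γ) (x : E d) : ℝ := ψ (klein A.1⁻¹ x)

/-- The sum of all translates of a weight function. -/
noncomputable def totalWeight (Γ : Subgroup (OPlus d)) (ψ : E d → ℝ) (x : E d) : ℝ :=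
  ∑ᶠ A : Γ, weight ψ A x

/-- The average of the affine functions `x ↦ ⟨(x, 1), τ(A)⟩` with the weights `weight ψ A`. -/
noncomputable def average (ψ : E d → ℝ) (τ : Z1 Γ) (x : E d) : ℝ :=
  (∑ᶠ A : Γ, weight ψ A x * mink (x, 1) (τ.1 A)) / totalWeight Γ ψ x

/-- A smooth nonnegative weight with compact support in the ball, such that the supports of its
translates form a locally finite cover. -/
structure IsWeight (Γ : Subgroup (OPlus d)) (ψ : E d → ℝ) : Prop where
  smooth : ContDiff ℝ ∞ ψ
  nonneg : ∀ x, 0 ≤ ψ x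
  locallyFinite : ∀ s < 1, ∃ F : Finset Γ, ∀ x ∈ Metric.closedBall (0 : E d) s, ∀ A ∉ F,
    weight ψ A x = 0
  cover : ∀ x ∈ B d, ∃ A : Γ, 0 < weight ψ A x

theorem exists_isWeight (hΓ : IsCompactHyperbolicManifold Γ) : ∃ ψ, IsWeight Γ ψ := by
  obtain ⟨r, hr0, hr1, hr⟩ := exists_radius hΓ
  -- The bump is 1 on a closed ball meeting every orbit, so its translates cover; the outer radius
  -- `(1 + r) / 2` keeps its support inside the unit ball.
  let ψ : ContDiffBump (0 : E d) := ⟨r, (1 + r) / 2, hr0, by linarith⟩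
  refine ⟨ψ, ψ.contDiff, fun x => ψ.nonneg, fun s hs => ?_, fun x hx => ?_⟩
  · refine ⟨(finite_klein_meets hΓ (show (1 + r) / 2 < 1 by linarith) hs).toFinset,
      fun x hx A hA => ?_⟩
    rw [Finite.mem_toFinset] at hA
    by_contra h
    refine hA ⟨x, hx, Metric.ball_subset_closedBall ?_⟩
    have : klein A.1⁻¹ x ∈ Function.support ψ := h
    rwa [ψ.support_eq] at this
  · obtain ⟨A, hA⟩ := hr x hx
    refine ⟨A, ?_⟩
    rw [weight, ψ.one_of_mem_closedBall hA]
    exact one_pos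

variable {ψ : E d → ℝ}

theorem IsWeight.finite_support (hψ : IsWeight Γ ψ) {x : E d} (hx : x ∈ B d) :
    (Function.support fun A : Γ => weight ψ A x).Finite := by
  obtain ⟨F, hF⟩ := hψ.locallyFinite ‖x‖ (mem_B.1 hx)
  refine F.finite_toSet.subset fun A hA => ?_
  by_contra h
  exact hA (hF x (by simp) A h)

theorem IsWeight.totalWeight_eq {s : ℝ} {F : Finset Γ}
    (hF : ∀ x ∈ Metric.closedBall (0 : E d) s, ∀ A ∉ F, weight ψ A x = 0) {x : E d}
    (hx : x ∈ Metric.closedBall (0 : E d) s) : totalWeight Γ ψ x = ∑ A ∈ F, weight ψ A x := by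
  refine finsum_eq_sum_of_support_subset _ fun A hA => ?_
  by_contra h
  exact hA (hF x hx A h)

theorem IsWeight.totalWeight_pos (hψ : IsWeight Γ ψ) {x : E d} (hx : x ∈ B d) :
    0 < totalWeight Γ ψ x := by
  obtain ⟨A, hA⟩ := hψ.cover x hx
  exact finsum_pos (fun A => hψ.nonneg _) ⟨A, hA⟩ (hψ.finite_support hx)

theorem weight_klein (ψ : E d → ℝ) (A A' : Γ) {x : E d} (hx : x ∈ B d) :
    weight ψ A (klein A'.1⁻¹ x) = weight ψ (A' * A) x := by
  rw [weight, weight, klein_klein _ _ hx, Subgroup.coe_mul, mul_inv_rev]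

theorem totalWeight_klein (ψ : E d → ℝ) (A : Γ) {x : E d} (hx : x ∈ B d) :
    totalWeight Γ ψ (klein A.1⁻¹ x) = totalWeight Γ ψ x := by
  simp only [totalWeight, weight_klein ψ _ A hx]
  exact finsum_comp_equiv (Equiv.mulLeft A) (f := fun A => weight ψ A x)

/-- The left side is the product of `A⁻¹ (x, 1)` with `τ A'`. The isometry `A` turns it into the
product of `(x, 1)` with `A (τ A')`, which is `τ (A * A') - τ A` by the cocycle relation. -/
theorem mink_klein (A : Γ) (τ : Z1 Γ) (A' : Γ) {x : E d} (hx : x ∈ B d) :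
    ((A.1⁻¹).1 (x, 1)).2 * mink (klein A.1⁻¹ x, 1) (τ.1 A')
      = mink (x, 1) (τ.1 (A * A')) - mink (x, 1) (τ.1 A) := by
  rw [← mink_smul_left, ← apply_eq_smul A.1⁻¹ hx, τ.2 A A', mink_add_right, add_sub_cancel_left,
    ← A.1.2.1 ((A.1⁻¹).1 (x, 1))]
  congr 1
  exact A.1.1.apply_symm_apply _

/-- The action permutes both the affine functions and the weights by left multiplication by `A`;
reindexing the sum restores the average, and the leftover `τ A` term cancels the translation part of
`act`. -/
theorem IsWeight.act_average (hψ : IsWeight Γ ψ) (τ : Z1 Γ) (A : Γ) {x : E d} (hx : x ∈ B d) :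
    act A.1 (τ.1 A) (average ψ τ) x = average ψ τ x := by
  have hS := (hψ.totalWeight_pos hx).ne'
  have h1 : ((A.1⁻¹).1 (x, 1)).2 * ∑ᶠ A' : Γ, weight ψ A' (klein A.1⁻¹ x) *
      mink (klein A.1⁻¹ x, 1) (τ.1 A') = (∑ᶠ A' : Γ, weight ψ A' x * mink (x, 1) (τ.1 A'))
        - totalWeight Γ ψ x * mink (x, 1) (τ.1 A) := by
    have h2 := hψ.finite_support hx
    rw [mul_finsum, totalWeight, finsum_mul, ← finsum_sub_distrib,
      ← finsum_comp_equiv (Equiv.mulLeft A) (f := fun A' => weight ψ A' x *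
        mink (x, 1) (τ.1 A') - weight ψ A' x * mink (x, 1) (τ.1 A))]
    · refine finsum_congr fun A' => ?_
      rw [mul_left_comm, mink_klein A τ A' hx, weight_klein ψ A' A hx]
      simp only [Equiv.coe_mulLeft]
      ring
    · exact h2.subset (Function.support_mul_subset_left _ _)
    · exact h2.subset (Function.support_mul_subset_left _ _)
  rw [act, L_div_L_klein _ hx, average, totalWeight_klein ψ A hx, ← mul_div_assoc, h1, average,
    sub_div, mul_div_cancel_left₀ _ hS]
  simp only [mink]
  ring

/-- The linear form `mink · v`. -/
noncomputable def minkCLM (v : V d) : V d →L[ℝ] ℝ :=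
  (innerSL ℝ v.1).comp (ContinuousLinearMap.fst ℝ (E d) ℝ)
    - v.2 • ContinuousLinearMap.snd ℝ (E d) ℝ

theorem minkCLM_apply (v p : V d) : minkCLM v p = mink p v := by
  simp [minkCLM, mink, real_inner_comm, mul_comm]

theorem continuous_minkCLM : Continuous (minkCLM (d := d)) := by
  unfold minkCLM
  fun_prop

/-- The linear form `p ↦ ∑ A ∈ F, ⟨p A, τ(A)⟩`. -/
noncomputable def coeffs (F : Finset Γ) (τ : Z1 Γ) : (F → V d) →L[ℝ] ℝ :=
  ∑ A : F, (minkCLM (τ.1 A)).comp (ContinuousLinearMap.proj A)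

theorem continuous_coeffs (F : Finset Γ) : Continuous (coeffs F) := by
  refine continuous_finsetSum _ fun A _ => Continuous.clm_comp ?_ continuous_const
  exact continuous_minkCLM.comp ((_root_.continuous_apply A.1).comp continuous_subtype_val)

/-- The vectors whose products with the `τ(A)`, for `A ∈ F`, sum up to `average ψ τ`. -/
noncomputable def weightedLift (ψ : E d → ℝ) (F : Finset Γ) (x : E d) : F → V d := fun A =>
  (weight ψ A.1 x / totalWeight Γ ψ x) • (x, 1)

/-- This separates variables: `coeffs F τ` carries all dependence on `τ`, and `weightedLift ψ F` all
dependence on `x`. -/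
theorem average_eq_coeffs {s : ℝ} {F : Finset Γ}
    (hF : ∀ x ∈ Metric.closedBall (0 : E d) s, ∀ A ∉ F, weight ψ A x = 0) {x : E d}
    (hx : x ∈ Metric.closedBall (0 : E d) s) (τ : Z1 Γ) :
    average ψ τ x = coeffs F τ (weightedLift ψ F x) := by
  rw [average, finsum_eq_sum_of_support_subset (s := F), Finset.sum_div, ← Finset.sum_coe_sort]
  · simp only [coeffs, sum_apply, ContinuousLinearMap.comp_apply,
      ContinuousLinearMap.proj_apply, minkCLM_apply, weightedLift, mink_smul_left]
    refine Finset.sum_congr rfl fun A _ => ?_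
    ring
  · intro A hA
    by_contra h
    exact left_ne_zero_of_mul hA (hF x hx A h)

theorem IsWeight.contDiffOn_weight (hψ : IsWeight Γ ψ) (A : Γ) :
    ContDiffOn ℝ ∞ (weight ψ A) (B d) :=
  hψ.smooth.comp_contDiffOn (contDiffOn_klein A.1⁻¹)

theorem IsWeight.contDiffOn_weightedLift (hψ : IsWeight Γ ψ) {s : ℝ} (hs : s < 1) {F : Finset Γ}
    (hF : ∀ x ∈ Metric.closedBall (0 : E d) s, ∀ A ∉ F, weight ψ A x = 0) :
    ContDiffOn ℝ ∞ (weightedLift ψ F) (Metric.ball 0 s) := by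
  have hsub : Metric.ball (0 : E d) s ⊆ B d := Metric.ball_subset_ball hs.le
  have h1 : ContDiffOn ℝ ∞ (totalWeight Γ ψ) (Metric.ball 0 s) :=
    (ContDiffOn.sum fun A _ => (hψ.contDiffOn_weight A).mono hsub).congr fun x hx => by
      rw [IsWeight.totalWeight_eq hF (Metric.ball_subset_closedBall hx)]
  have h2 : ContDiff ℝ ∞ fun x : E d => ((x, 1) : V d) := contDiff_id.prodMk contDiff_const
  refine contDiffOn_pi.2 fun A => ContDiffOn.smul
    (f := fun x => weight ψ A.1 x / totalWeight Γ ψ x) ?_ h2.contDiffOn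
  exact ((hψ.contDiffOn_weight A.1).mono hsub).div h1 fun x hx =>
    (hψ.totalWeight_pos (hsub hx)).ne'

theorem exists_between_norm {x : E d} (hx : x ∈ B d) :
    ∃ s < 1, x ∈ Metric.ball (0 : E d) s := by
  obtain ⟨s, hs, hs1⟩ := exists_between (mem_B.1 hx)
  exact ⟨s, hs1, mem_ball_zero_iff.2 hs⟩

theorem IsWeight.contDiffOn_average (hψ : IsWeight Γ ψ) (τ : Z1 Γ) :
    ContDiffOn ℝ ∞ (average ψ τ) (B d) := by
  intro x hx
  obtain ⟨s, hs, hxs⟩ := exists_between_norm hx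
  obtain ⟨F, hF⟩ := hψ.locallyFinite s hs
  refine ContDiffAt.contDiffWithinAt ?_
  refine ContDiffOn.contDiffAt (s := Metric.ball 0 s) ?_ (Metric.isOpen_ball.mem_nhds hxs)
  exact ((coeffs F τ).contDiff.comp_contDiffOn (hψ.contDiffOn_weightedLift hs hF)).congr
    fun y hy => average_eq_coeffs hF (Metric.ball_subset_closedBall hy) τ

theorem IsWeight.exists_hessian_average_bound (hψ : IsWeight Γ ψ) {r : ℝ} (hr : r < 1) :
    ∃ c : Z1 Γ → ℝ, Continuous c ∧ (∀ τ, 0 ≤ c τ) ∧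
      ∀ τ, ∀ x ∈ Metric.closedBall (0 : E d) r, ∀ w,
        |fderiv ℝ (fderiv ℝ (average ψ τ)) x w w| ≤ c τ * ‖w‖ ^ 2 := by
  -- The slightly larger radius gives an open neighbourhood of the closed ball on which a single
  -- finite set `F` suffices.
  obtain ⟨s, hrs, hs⟩ := exists_between hr
  obtain ⟨F, hF⟩ := hψ.locallyFinite s hs
  have hsub : Metric.closedBall (0 : E d) r ⊆ Metric.ball 0 s :=
    Metric.closedBall_subset_ball hrs
  obtain ⟨C, hC0, hC⟩ := exists_hessian_bound Metric.isOpen_ball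
    (hψ.contDiffOn_weightedLift hs hF) (isCompact_closedBall (0 : E d) r) hsub
  refine ⟨fun τ => C * ‖coeffs F τ‖, continuous_const.mul (continuous_coeffs F).norm,
    fun τ => by positivity, fun τ x hx w => ?_⟩
  have h1 : average ψ τ =ᶠ[𝓝 x] fun y => coeffs F τ (weightedLift ψ F y) := by
    filter_upwards [Metric.isOpen_ball.mem_nhds (hsub hx)] with y hy
    exact average_eq_coeffs hF (Metric.ball_subset_closedBall hy) τ
  rw [h1.fderiv.fderiv_eq]
  exact hC _ x hx w

/-! ### Convexity by subtracting a multiple of `L` -/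

theorem act_sub_mul_L (A : OPlus d) (v : V d) (h : E d → ℝ) (c : ℝ) {x : E d} (hx : x ∈ B d) :
    act A v (fun y => h y - c * L y) x = act A v h x - c * L x := by
  have h1 := (L_pos (klein_mem A⁻¹ hx)).ne'
  simp only [act]
  field_simp
  ring

/-- Smooth convex equivariant functions, depending continuously on the cocycle. -/
theorem exists_convex_equivariant (hΓ : IsCompactHyperbolicManifold Γ) :
    ∃ h : Z1 Γ → E d → ℝ,
      (∀ τ : Z1 Γ, ContDiffOn ℝ ∞ (h τ) (B d) ∧ ConvexOn ℝ (B d) (h τ) ∧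
        IsEquivariant τ (h τ)) ∧
      ∀ (τ : Z1 Γ) (τs : ℕ → Z1 Γ), Tendsto τs atTop (𝓝 τ) →
        ConvergesWithSecondDerivs (fun n => h (τs n)) (h τ) := by
  obtain ⟨r, -, hr1, hr⟩ := exists_radius hΓ
  obtain ⟨ψ, hψ⟩ := exists_isWeight hΓ
  obtain ⟨c, hc, hc0, hcb⟩ := hψ.exists_hessian_average_bound hr1
  have hsmooth : ∀ τ, ContDiffOn ℝ ∞ (fun x => average ψ τ x - c τ * L x) (B d) := fun τ =>
    (hψ.contDiffOn_average τ).sub (contDiffOn_const.mul (contDiffOn_L d))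
  have hact : ∀ τ : Z1 Γ, ∀ A : Γ, ∀ x ∈ B d,
      act A.1 (τ.1 A) (fun x => average ψ τ x - c τ * L x) x = average ψ τ x - c τ * L x :=
    fun τ A x hx => by rw [act_sub_mul_L _ _ _ _ hx, hψ.act_average τ A hx]
  refine ⟨fun τ x => average ψ τ x - c τ * L x, fun τ => ⟨hsmooth τ, ?_,
    (hsmooth τ).continuousOn, hact τ⟩, fun τ τs hτ => ?_⟩
  · refine convexOn_of_fderiv_fderiv_nonneg (isOpen_B d) (convex_ball 0 1) (hsmooth τ) ?_
    intro x hx w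
    -- The Hessian bound is known only on the closed ball of radius `r`, so the point is first moved
    -- there by a group element.
    obtain ⟨A, hA⟩ := hr x hx
    obtain ⟨a, ha, w', h⟩ := hessian_eq_of_act_eq (hsmooth τ) (hact τ A) hx w
    have hy := mem_B_of_mem_closedBall hr1 hA
    rw [h, fderiv_fderiv_sub_mul (isOpen_B d) (hψ.contDiffOn_average τ) (contDiffOn_L d) _ hy]
    refine div_nonneg ?_ ha.le
    have h1 := (abs_le.1 (hcb τ _ hA w')).1
    have h2 := mul_le_mul_of_nonneg_left (hessian_L_le hy w') (hc0 τ)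
    linarith
  · refine convergesWithSecondDerivs_of_locally_linear fun x hx => ?_
    obtain ⟨s, hs, hxs⟩ := exists_between_norm hx
    obtain ⟨F, hF⟩ := hψ.locallyFinite s hs
    -- Adjoining `L` as one more coordinate, with coefficient `-c τ`, makes the corrected function
    -- linear in its coefficients as well.
    let ℓ : Z1 Γ → (F → V d) × ℝ →L[ℝ] ℝ := fun τ =>
      (coeffs F τ).comp (ContinuousLinearMap.fst ℝ _ _) - c τ • ContinuousLinearMap.snd ℝ _ _
    have hℓ : Continuous ℓ :=
      ((continuous_coeffs F).clm_comp continuous_const).sub (hc.smul continuous_const)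
    have heq : ∀ τ, ∀ y ∈ Metric.ball (0 : E d) s,
        average ψ τ y - c τ * L y = ℓ τ (weightedLift ψ F y, L y) := fun τ y hy => by
      rw [average_eq_coeffs hF (Metric.ball_subset_closedBall hy) τ]
      rfl
    exact ⟨(F → V d) × ℝ, inferInstance, inferInstance, Metric.ball 0 s,
      fun y => (weightedLift ψ F y, L y), fun n => ℓ (τs n), ℓ τ, Metric.isOpen_ball, hxs,
      (hψ.contDiffOn_weightedLift hs hF).prodMk
        ((contDiffOn_L d).mono (Metric.ball_subset_ball hs.le)),
      (hℓ.tendsto τ).comp hτ, fun n => heq (τs n), heq τ⟩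

theorem IsEquivariant.neg {τ : Z1 Γ} {h : E d → ℝ} (hh : IsEquivariant (-τ) h) :
    IsEquivariant τ (-h) := by
  refine ⟨hh.1.neg, fun A x hx => ?_⟩
  have h1 := hh.2 A x hx
  have h2 : (-τ).1 A = -τ.1 A := rfl
  simp only [act, h2, Prod.fst_neg, Prod.snd_neg, inner_neg_right, Pi.neg_apply] at h1 ⊢
  linarith

theorem ConvergesWithSecondDerivs.neg {f : ℕ → E d → ℝ} {g : E d → ℝ}
    (h : ConvergesWithSecondDerivs f g) :
    ConvergesWithSecondDerivs (fun n => -f n) (-g) := by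
  refine ⟨uniformContinuous_neg.comp_tendstoLocallyUniformlyOn h.1, ?_⟩
  have h1 : ∀ f : E d → ℝ, iteratedFDeriv ℝ 2 (-f) = Neg.neg ∘ iteratedFDeriv ℝ 2 f := fun f =>
    funext fun x => iteratedFDeriv_neg_apply
  simp only [h1]
  exact uniformContinuous_neg.comp_tendstoLocallyUniformlyOn h.2

end Average

end CoMinkowski

theorem mainTheorem8 (d : ℕ) (Γ : Subgroup (CoMinkowski.OPlus d))
    (hΓ : CoMinkowski.IsCompactHyperbolicManifold Γ) :
    (∃ h : CoMinkowski.Z1 Γ → CoMinkowski.E d → ℝ,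
      (∀ τ : CoMinkowski.Z1 Γ,
        ContDiffOn ℝ ∞ (h τ) (CoMinkowski.B d) ∧ ConvexOn ℝ (CoMinkowski.B d) (h τ) ∧
          CoMinkowski.IsEquivariant τ (h τ)) ∧
      ∀ (τ : CoMinkowski.Z1 Γ) (τs : ℕ → CoMinkowski.Z1 Γ), Tendsto τs atTop (𝓝 τ) →
        CoMinkowski.ConvergesWithSecondDerivs (fun n => h (τs n)) (h τ)) ∧
    (∃ h : CoMinkowski.Z1 Γ → CoMinkowski.E d → ℝ,
      (∀ τ : CoMinkowski.Z1 Γ,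
        ContDiffOn ℝ ∞ (h τ) (CoMinkowski.B d) ∧ ConcaveOn ℝ (CoMinkowski.B d) (h τ) ∧
          CoMinkowski.IsEquivariant τ (h τ)) ∧
      ∀ (τ : CoMinkowski.Z1 Γ) (τs : ℕ → CoMinkowski.Z1 Γ), Tendsto τs atTop (𝓝 τ) →
        CoMinkowski.ConvergesWithSecondDerivs (fun n => h (τs n)) (h τ)) := by
  obtain ⟨h, hh, hconv⟩ := CoMinkowski.exists_convex_equivariant hΓ
  refine ⟨⟨h, hh, hconv⟩, fun τ => -h (-τ), fun τ => ?_, fun τ τs hτ => ?_⟩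
  · obtain ⟨h1, h2, h3⟩ := hh (-τ)
    exact ⟨h1.neg, h2.neg, h3.neg⟩
  · refine (hconv (-τ) (fun n => -τs n) ?_).neg
    -- Convergence of cocycles is convergence in the ambient product space, where negation is
    -- continuous.
    rw [tendsto_subtype_rng] at hτ ⊢
    exact hτ.neg
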